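/- Let $P\subset\mathbb R^3$ be a convex polyhedron (the convex hull of finitely many points, with nonempty interior). Its \emph{edge skeleton linkage} $L$ has the vertices of $P$ as joints and the edges of $P$ as rigid bars, each with its Euclidean length. Let $L'$ be the linkage obtained from $L$ by subdividing every edge at its midpoint: each bar $AB$ is replaced by a new joint $M$ and two bars $AM$, $MB$ of length $|AB|/2$. A \emph{state} of $L'$ is a placement of its joints in $\mathbb R^3$ such that every bar, drawn as a straight segment, has its assigned length. A (\emph{sticky}) \emph{motion} of $L'$ is a family of states $(S_t)_{t\in[0,1]}$, continuous in $t$, such that whenever two points of bars (each given by its relative position on its bar) coincide at some time $s$, they coincide at every time $t\ge s$; in particular bars may touch but never cross. Then there is a sticky motion $(S_t)_{t\in[0,1]}$ of $L'$ such that $S_0$ is the given initial state (every vertex of $P$ at its own place and every new joint at the midpoint of its edge) and $S_1$ is flat: all joints lie in the $xy$-plane. Moreover, the linkage can be continuously moved on to lie in a straight line: there is a sticky motion $(T_t)_{t\in[0,1]}$ of $L'$ with $T_0=S_1$ such that all joints in $T_1$ lie on one line. -/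

import Mathlib

/-- Euclidean 3-space. -/
abbrev Space : Type := EuclideanSpace ℝ (Fin 3)

/-- A linkage: a graph together with an assignment of (positive) lengths to its edges.
The values of `length` off the edge set carry no meaning and are never used. -/
structure Linkage (V : Type*) where
  graph : SimpleGraph V
  length : Sym2 V → ℝ
  length_pos : ∀ e ∈ graph.edgeSet, 0 < length e

namespace Linkage

variable {V : Type*}

/-- A state (configuration) of a linkage: a placement of the joints in space such that every bar,
drawn as a straight segment, has its assigned length. -/
def IsState (L : Linkage V) (S : V → Space) : Prop :=
  ∀ u v : V, L.graph.Adj u v → dist (S u) (S v) = L.length s(u, v)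

/-- The stickiness condition for a family of placements indexed by time: whenever at some time `s`
the point at relative position `x` of the bar `uv` touches the point at relative position `x'` of
the bar `u'v'`, these two points coincide at every later time `t`. -/
def IsSticky (L : Linkage V) (S : unitInterval → V → Space) : Prop :=
  ∀ s t : unitInterval, s ≤ t →
    ∀ u v u' v' : V, L.graph.Adj u v → L.graph.Adj u' v' →
      ∀ x ∈ Set.Icc (0 : ℝ) 1, ∀ x' ∈ Set.Icc (0 : ℝ) 1,
        AffineMap.lineMap (S s u) (S s v) x = AffineMap.lineMap (S s u') (S s v') x' →
          AffineMap.lineMap (S t u) (S t v) x = AffineMap.lineMap (S t u') (S t v') x'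

/-- A motion of a linkage in the sticky model: a continuous family of states
(so that bar lengths are preserved), indexed by time in `[0, 1]`, that is sticky. -/
structure IsStickyMotion (L : Linkage V) (S : unitInterval → V → Space) : Prop where
  continuous : Continuous S
  isState : ∀ t, L.IsState (S t)
  isSticky : L.IsSticky S

/-- The linkage obtained by subdividing every edge at its midpoint. Its joints are the old joints
and one new joint for every edge; the new joint of an edge `e` is joined to the two ends of `e`
by bars of half the length of `e`. -/
noncomputable def midpointSubdivision (L : Linkage V) : Linkage (V ⊕ L.graph.edgeSet) where
  graph :=
    { Adj := fun p q => match p, q with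
        | Sum.inl v, Sum.inr e => v ∈ (e : Sym2 V)
        | Sum.inr e, Sum.inl v => v ∈ (e : Sym2 V)
        | _, _ => False
      symm := ⟨by rintro (_ | _) (_ | _) h <;> exact h⟩
      loopless := ⟨by rintro (_ | _) h <;> exact h⟩ }
  length := Sym2.lift
    ⟨fun p q => match p, q with
        | Sum.inl _, Sum.inr e => L.length e / 2
        | Sum.inr e, Sum.inl _ => L.length e / 2
        | _, _ => 0,
      by rintro (_ | _) (_ | _) <;> rfl⟩
  length_pos := by
    intro e
    induction e using Sym2.ind with
    | _ p q =>
      rcases p with v | e <;> rcases q with w | f <;> intro h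
      · exact h.elim
      · exact half_pos (L.length_pos f f.2)
      · exact half_pos (L.length_pos e e.2)
      · exact h.elim

/-- The placement of the joints of the subdivided linkage induced by a placement `S` of the joints
of `L`: old joints stay, the new joint of an edge is placed at the midpoint of that edge. -/
noncomputable def subdividedPlacement (L : Linkage V) (S : V → Space) :
    V ⊕ L.graph.edgeSet → Space
  | Sum.inl v => S v
  | Sum.inr e => Sym2.lift ⟨fun a b => midpoint ℝ (S a) (S b), fun _ _ => midpoint_comm _ _⟩ e.1

end Linkage

/-- A convex polyhedron in 3-space: the convex hull of finitely many points,
with nonempty interior. -/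
def IsConvexPolyhedron (P : Set Space) : Prop :=
  (∃ F : Finset Space, P = convexHull ℝ (F : Set Space)) ∧ (interior P).Nonempty

/-- The linkage of a convex polyhedron `P`, that is, its edge skeleton: the joints are the vertices
(extreme points) of `P`, two distinct vertices are joined by a bar iff the segment between them is
a face of `P` (the intersection of `P` with a supporting plane), and the length of the bar is the
distance of its ends. -/
noncomputable def polyhedralLinkage (P : Set Space) : Linkage (Set.extremePoints ℝ P) where
  graph :=
    { Adj := fun A B => A ≠ B ∧ IsExposed ℝ P (segment ℝ (A : Space) (B : Space))
      symm := ⟨fun A B h => ⟨h.1.symm, segment_symm ℝ (A : Space) (B : Space) ▸ h.2⟩⟩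
      loopless := ⟨fun _ h => h.1 rfl⟩ }
  length := Sym2.lift ⟨fun A B => dist (A : Space) (B : Space), fun _ _ => dist_comm _ _⟩
  length_pos := by
    intro e
    induction e using Sym2.ind with
    | _ A B =>
      intro h
      exact dist_pos.2 fun hAB => h.1 (Subtype.ext hAB)

/-- The given initial state of the subdivided linkage of a convex polyhedron `P`: every vertex is
at its place on `P` and every new joint is at the midpoint of its edge. -/
noncomputable def initialPlacement (P : Set Space) :
    Set.extremePoints ℝ P ⊕ (polyhedralLinkage P).graph.edgeSet → Space :=
  (polyhedralLinkage P).subdividedPlacement (fun A => (A : Space))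

/-! Shrink the polyhedron by a factor `a` going from 1 to 0, and push the midpoint of each edge of
length `ℓ` out along a fixed outer unit normal by `ℓ/2 * √(1 - a ^ 2)`. The normal is orthogonal to
its edge, so Pythagoras keeps every half-edge at length `ℓ/2`. While `a > 0`, each point of a bar is
`a • q` plus a nonnegative multiple of a normal at `q`, where `q` is its original place; uniqueness
of nearest points in a convex set (`eq_of_add_normal_eq`) recovers `q`, so no new contacts arise. At
`a = 0` all vertices are at the origin and the bars form a star, each edge being folded to one arm.
Two arms then touch away from the origin only if they have the same direction. The arms are turned
by applying a path of linear maps to the normals and normalizing. These maps (`collapse`) identify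
no further directions before the end of each stage; the first stage ends in the plane, the second on
a line. A generic parameter `τ` keeps every image nonzero (`exists_forall_collapse_ne_zero`). -/

open Set

/-! ### Outer normals of edges and nearest-point uniqueness. -/

section OuterNormal

/-- `n` is an outer unit normal of `P` at both ends of `e`. -/
def IsOuterUnitNormal (P : Set Space) (e : Sym2 (Set.extremePoints ℝ P)) (n : Space) : Prop :=
  ‖n‖ = 1 ∧ ∀ v ∈ e, ∀ z ∈ P, inner ℝ n (z - (v : Space)) ≤ 0

theorem interior_segment_eq_empty (A B : Space) : interior (segment ℝ A B) = ∅ := by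
  by_contra h
  rw [← ne_eq, ← nonempty_iff_ne_empty, ← convexHull_pair,
    interior_convexHull_nonempty_iff_affineSpan_eq_top] at h
  have h1 : Module.finrank ℝ (vectorSpan ℝ ({A, B} : Set Space)) ≤ 1 :=
    collinear_iff_finrank_le_one.1 (collinear_pair ℝ A B)
  rw [← direction_affineSpan, h, AffineSubspace.direction_top, finrank_top,
    finrank_euclideanSpace_fin] at h1
  omega

theorem exists_isOuterUnitNormal {P : Set Space} (hP : (interior P).Nonempty)
    {e : Sym2 (Set.extremePoints ℝ P)} (he : e ∈ (polyhedralLinkage P).graph.edgeSet) :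
    ∃ n, IsOuterUnitNormal P e n := by
  induction e using Sym2.ind with
  | _ A B =>
    obtain ⟨-, hexp⟩ : A ≠ B ∧ IsExposed ℝ P (segment ℝ (A : Space) (B : Space)) := he
    obtain ⟨l, hl⟩ := hexp ⟨A, left_mem_segment ℝ _ _⟩
    have hA : (A : Space) ∈ {x ∈ P | ∀ y ∈ P, l y ≤ l x} := hl ▸ left_mem_segment ℝ _ _
    have hB : (B : Space) ∈ {x ∈ P | ∀ y ∈ P, l y ≤ l x} := hl ▸ right_mem_segment ℝ _ _
    -- The zero functional exposes all of `P`, which has interior points, unlike a segment.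
    have hl0 : l ≠ 0 := by
      rintro rfl
      have : segment ℝ (A : Space) B = P := by rw [hl]; ext x; simp
      rw [← this, interior_segment_eq_empty] at hP
      exact hP.ne_empty rfl
    set g : Space := (InnerProductSpace.toDual ℝ Space).symm l with hg
    have hg0 : g ≠ 0 := by simpa [hg] using hl0
    have hgl : ∀ x, inner ℝ g x = l x := fun x => InnerProductSpace.toDual_symm_apply
    refine ⟨‖g‖⁻¹ • g, norm_smul_inv_norm hg0, fun v hv z hz => ?_⟩
    rw [real_inner_smul_left, hgl, map_sub]
    refine mul_nonpos_of_nonneg_of_nonpos (by positivity) (sub_nonpos.2 ?_)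
    rcases Sym2.mem_iff.1 hv with rfl | rfl
    exacts [hA.2 z hz, hB.2 z hz]

/-- Nearest-point uniqueness: a point of the form `q + σ • n` with `n` in the normal cone of `P` at
`q` determines `q`. -/
theorem eq_of_add_normal_eq {P : Set Space} {q q' n n' : Space} {σ σ' : ℝ} (hq : q ∈ P)
    (hq' : q' ∈ P) (hσ : 0 ≤ σ) (hσ' : 0 ≤ σ') (hn : ∀ z ∈ P, inner ℝ n (z - q) ≤ 0)
    (hn' : ∀ z ∈ P, inner ℝ n' (z - q') ≤ 0) (h : q + σ • n = q' + σ' • n') : q = q' := by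
  have h1 : q - q' = σ' • n' - σ • n := by
    rw [sub_eq_sub_iff_add_eq_add, h, add_comm]
  have h2 : inner ℝ (q - q') (q - q') = σ' * inner ℝ n' (q - q') + σ * inner ℝ n (q' - q) := by
    conv_lhs => arg 2; rw [h1]
    rw [inner_sub_left, real_inner_smul_left, real_inner_smul_left, ← neg_sub q q', inner_neg_right]
    ring
  have h3 : inner ℝ (q - q') (q - q') ≤ 0 := by
    rw [h2]
    exact add_nonpos (mul_nonpos_of_nonneg_of_nonpos hσ' (hn' q hq))
      (mul_nonpos_of_nonneg_of_nonpos hσ (hn q' hq'))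
  exact sub_eq_zero.1 (inner_self_eq_zero (𝕜 := ℝ).1 (le_antisymm h3 real_inner_self_nonneg))

end OuterNormal

/-! ### Intersections of half-edges of the polyhedron. -/

section Edges

variable {P : Set Space}

theorem initialPlacement_inr_eq_midpoint {e : (polyhedralLinkage P).graph.edgeSet}
    {A B : Set.extremePoints ℝ P} (h : (e : Sym2 (Set.extremePoints ℝ P)) = s(A, B)) :
    initialPlacement P (Sum.inr e) = midpoint ℝ (A : Space) B := by
  simp only [initialPlacement, Linkage.subdividedPlacement, h, Sym2.lift_mk]

theorem polyhedralLinkage_length_eq_dist {e : (polyhedralLinkage P).graph.edgeSet}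
    {A B : Set.extremePoints ℝ P} (h : (e : Sym2 (Set.extremePoints ℝ P)) = s(A, B)) :
    (polyhedralLinkage P).length e = dist (A : Space) B := by
  rw [h]; rfl

/-- The point at relative position `y` of the half-edge from the vertex `A` to the midpoint of
`e`. -/
noncomputable def halfEdgePoint (A : Set.extremePoints ℝ P)
    (e : (polyhedralLinkage P).graph.edgeSet) (y : ℝ) : Space :=
  AffineMap.lineMap (A : Space) (initialPlacement P (Sum.inr e)) y

theorem halfEdgePoint_eq {e : (polyhedralLinkage P).graph.edgeSet}
    {A B : Set.extremePoints ℝ P} (h : (e : Sym2 (Set.extremePoints ℝ P)) = s(A, B)) (y : ℝ) :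
    halfEdgePoint A e y = AffineMap.lineMap (A : Space) (B : Space) (y / 2) := by
  rw [halfEdgePoint, initialPlacement_inr_eq_midpoint h]
  simp only [AffineMap.lineMap_apply_module, midpoint_eq_smul_add, invOf_eq_inv]
  module

theorem halfEdgePoint_mem_segment {e : (polyhedralLinkage P).graph.edgeSet}
    {A B : Set.extremePoints ℝ P} (h : (e : Sym2 (Set.extremePoints ℝ P)) = s(A, B)) {y : ℝ}
    (hy : y ∈ Icc (0 : ℝ) 1) : halfEdgePoint A e y ∈ segment ℝ (A : Space) B := by
  rw [halfEdgePoint_eq h, segment_eq_image_lineMap]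
  exact ⟨y / 2, ⟨by linarith [hy.1], by linarith [hy.2]⟩, rfl⟩

theorem isExposed_of_edge {e : (polyhedralLinkage P).graph.edgeSet}
    {A B : Set.extremePoints ℝ P} (h : (e : Sym2 (Set.extremePoints ℝ P)) = s(A, B)) :
    A ≠ B ∧ IsExposed ℝ P (segment ℝ (A : Space) B) := by
  have := e.2
  rw [h] at this
  exact this

theorem IsOuterUnitNormal.inner_halfEdgePoint_le {e : (polyhedralLinkage P).graph.edgeSet}
    {n : Space} (hn : IsOuterUnitNormal P e n) {A : Set.extremePoints ℝ P}
    (hA : A ∈ (e : Sym2 (Set.extremePoints ℝ P))) {y : ℝ} (hy : y ∈ Icc (0 : ℝ) 1) :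
    ∀ z ∈ P, inner ℝ n (z - halfEdgePoint A e y) ≤ 0 := by
  intro z hz
  obtain ⟨B, hB⟩ := hA
  have h1 := hn.2 A (hB ▸ Sym2.mem_mk_left A B) z hz
  have h2 := hn.2 B (hB ▸ Sym2.mem_mk_right A B) z hz
  have : z - halfEdgePoint A e y
      = (1 - y / 2) • (z - (A : Space)) + (y / 2) • (z - (B : Space)) := by
    rw [halfEdgePoint_eq hB, AffineMap.lineMap_apply_module]
    module
  rw [this, inner_add_right, real_inner_smul_right, real_inner_smul_right]
  exact add_nonpos (mul_nonpos_of_nonneg_of_nonpos (by linarith [hy.2]) h1)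
    (mul_nonpos_of_nonneg_of_nonpos (by linarith [hy.1]) h2)

theorem IsOuterUnitNormal.inner_sub_eq_zero {e : Sym2 (Set.extremePoints ℝ P)}
    {n : Space} (hn : IsOuterUnitNormal P e n) {A B : Set.extremePoints ℝ P}
    (hA : A ∈ e) (hB : B ∈ e) : inner ℝ n ((A : Space) - B) = 0 := by
  refine le_antisymm (hn.2 B hB A A.2.1) ?_
  have := hn.2 A hA B B.2.1
  rw [← neg_sub, inner_neg_right] at this
  linarith

/-- Half-edges of different edges meet in common vertices only. -/
theorem halfEdgePoint_eq_zero_of_ne {e e' : (polyhedralLinkage P).graph.edgeSet}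
    {A A' : Set.extremePoints ℝ P} (hA : A ∈ (e : Sym2 (Set.extremePoints ℝ P)))
    (hA' : A' ∈ (e' : Sym2 (Set.extremePoints ℝ P))) {y y' : ℝ} (hy : y ∈ Icc (0 : ℝ) 1)
    (hy' : y' ∈ Icc (0 : ℝ) 1) (h : halfEdgePoint A e y = halfEdgePoint A' e' y')
    (hne : e ≠ e') : y = 0 := by
  by_contra hy0
  obtain ⟨B, hB⟩ := hA
  obtain ⟨B', hB'⟩ := hA'
  obtain ⟨hAB, -⟩ := isExposed_of_edge hB
  obtain ⟨-, hexp'⟩ := isExposed_of_edge hB'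
  -- A half-edge parameter `y` is the parameter `y / 2 ≤ 1 / 2` on the whole edge, so only `y = 0`
  -- gives an end.
  have hopen : halfEdgePoint A e y ∈ openSegment ℝ (A : Space) B := by
    rw [halfEdgePoint_eq hB, openSegment_eq_image_lineMap]
    exact ⟨y / 2, ⟨by have := lt_of_le_of_ne hy.1 (Ne.symm hy0); linarith, by linarith [hy.2]⟩, rfl⟩
  have hmem : halfEdgePoint A e y ∈ segment ℝ (A' : Space) B' :=
    h ▸ halfEdgePoint_mem_segment hB' hy'
  have hends : ∀ C : Set.extremePoints ℝ P, (C : Space) ∈ segment ℝ (A' : Space) B' →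
      C = A' ∨ C = B' := by
    intro C hC
    have := (mem_extremePoints_iff_forall_segment.1 C.2).2 A' A'.2.1 B' B'.2.1 hC
    exact this.imp (fun h => Subtype.ext h.symm) (fun h => Subtype.ext h.symm)
  -- The edge `e'` is a face meeting the relative interior of `e`, so it contains both ends of `e`.
  have h1 := hends A (hexp'.isExtreme.left_mem_of_mem_openSegment A.2.1 B.2.1 hmem hopen)
  have h2 := hends B (hexp'.isExtreme.right_mem_of_mem_openSegment A.2.1 B.2.1 hmem hopen)
  apply hne
  apply Subtype.ext
  rw [hB, hB', Sym2.eq_iff]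
  rcases h1 with rfl | rfl <;> rcases h2 with rfl | rfl
  · exact absurd rfl hAB
  · exact Or.inl ⟨rfl, rfl⟩
  · exact Or.inr ⟨rfl, rfl⟩
  · exact absurd rfl hAB

/-- Two coinciding points of half-edges are a common vertex, a common midpoint, or the same point
of the same half-edge. -/
theorem halfEdgePoint_eq_cases {e e' : (polyhedralLinkage P).graph.edgeSet}
    {A A' : Set.extremePoints ℝ P} (hA : A ∈ (e : Sym2 (Set.extremePoints ℝ P)))
    (hA' : A' ∈ (e' : Sym2 (Set.extremePoints ℝ P))) {y y' : ℝ} (hy : y ∈ Icc (0 : ℝ) 1)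
    (hy' : y' ∈ Icc (0 : ℝ) 1) (h : halfEdgePoint A e y = halfEdgePoint A' e' y') :
    (y = 0 ∧ y' = 0 ∧ A = A') ∨ (e = e' ∧ y = 1 ∧ y' = 1) ∨ (e = e' ∧ A = A' ∧ y = y') := by
  by_cases hee : e = e'
  · subst hee
    right
    obtain ⟨B, hB⟩ := hA
    obtain ⟨hAB, -⟩ := isExposed_of_edge hB
    have hAB' : (A : Space) - B ≠ 0 := sub_ne_zero.2 fun h => hAB (Subtype.ext h)
    rw [halfEdgePoint_eq hB] at h
    rw [hB] at hA'
    rcases Sym2.mem_iff.1 hA' with rfl | rfl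
    · right
      rw [halfEdgePoint_eq hB, AffineMap.lineMap_apply_module, AffineMap.lineMap_apply_module] at h
      have : ((y' - y) / 2) • ((A' : Space) - B) = 0 := by
        rw [← sub_eq_zero] at h
        rw [← h]
        module
      have := (smul_eq_zero.1 this).resolve_right hAB'
      exact ⟨rfl, rfl, by linarith⟩
    · left
      rw [halfEdgePoint_eq (hB.trans Sym2.eq_swap), AffineMap.lineMap_apply_module,
        AffineMap.lineMap_apply_module] at h
      -- Opposite halves of one edge meet only if `y + y' = 2`, that is, at the midpoint.
      have : (1 - y / 2 - y' / 2) • ((A : Space) - A') = 0 := by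
        rw [← sub_eq_zero] at h
        rw [← h]
        module
      have := (smul_eq_zero.1 this).resolve_right hAB'
      exact ⟨rfl, by linarith [hy.2, hy'.2], by linarith [hy.2, hy'.2]⟩
  · left
    have h0 := halfEdgePoint_eq_zero_of_ne hA hA' hy hy' h hee
    have h0' := halfEdgePoint_eq_zero_of_ne hA' hA hy' hy h.symm (Ne.symm hee)
    subst h0 h0'
    simp only [halfEdgePoint, AffineMap.lineMap_apply_zero] at h
    exact ⟨rfl, rfl, Subtype.ext h⟩

end Edges

/-! ### Contraction to a star and its stickiness. -/

section Contraction

variable {P : Set Space}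

/-- The placement with the polyhedron scaled by `a`, in which the midpoint of every edge `e` has
been pushed in the direction `u e`. -/
noncomputable def contractedPlacement (P : Set Space) (a : ℝ)
    (u : (polyhedralLinkage P).graph.edgeSet → Space) :
    Set.extremePoints ℝ P ⊕ (polyhedralLinkage P).graph.edgeSet → Space
  | Sum.inl A => a • (A : Space)
  | Sum.inr e => a • initialPlacement P (Sum.inr e) +
      ((polyhedralLinkage P).length e / 2 * √(1 - a ^ 2)) • u e

/-- After division by `a > 0` this has the form `q + σ • n` required by `eq_of_add_normal_eq`. -/
theorem lineMap_contractedPlacement (a : ℝ) (u : (polyhedralLinkage P).graph.edgeSet → Space)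
    (A : Set.extremePoints ℝ P) (e : (polyhedralLinkage P).graph.edgeSet) (y : ℝ) :
    AffineMap.lineMap (contractedPlacement P a u (Sum.inl A))
      (contractedPlacement P a u (Sum.inr e)) y =
    a • halfEdgePoint A e y + (y * ((polyhedralLinkage P).length e / 2 * √(1 - a ^ 2))) • u e := by
  simp only [contractedPlacement, halfEdgePoint, AffineMap.lineMap_apply_module]
  module

theorem dist_contractedPlacement {a : ℝ} (ha : a ∈ Icc (0 : ℝ) 1)
    {u : (polyhedralLinkage P).graph.edgeSet → Space} {A : Set.extremePoints ℝ P}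
    {e : (polyhedralLinkage P).graph.edgeSet} (hA : A ∈ (e : Sym2 (Set.extremePoints ℝ P)))
    (hu : ‖u e‖ = 1) (hn : 0 < a → IsOuterUnitNormal P e (u e)) :
    dist (contractedPlacement P a u (Sum.inl A)) (contractedPlacement P a u (Sum.inr e)) =
      (polyhedralLinkage P).length e / 2 := by
  obtain ⟨B, hB⟩ := hA
  have hpos : 0 < (polyhedralLinkage P).length e := (polyhedralLinkage P).length_pos e e.2
  have hd : ‖(A : Space) - B‖ = (polyhedralLinkage P).length e := by
    rw [polyhedralLinkage_length_eq_dist hB, dist_eq_norm]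
  set ℓ := (polyhedralLinkage P).length e
  -- The cross term vanishes by orthogonality while `a > 0`, and trivially at `a = 0`, where `u e`
  -- may be any unit vector.
  have horth : a / 2 * inner ℝ ((A : Space) - B) (u e) = 0 := by
    rcases ha.1.eq_or_lt with h | h
    · rw [← h]; simp
    · rw [real_inner_comm, (hn h).inner_sub_eq_zero (hB ▸ Sym2.mem_mk_left A B)
        (hB ▸ Sym2.mem_mk_right A B), mul_zero]
  have hsub : contractedPlacement P a u (Sum.inl A) - contractedPlacement P a u (Sum.inr e) =
      (a / 2) • ((A : Space) - B) - (ℓ / 2 * √(1 - a ^ 2)) • u e := by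
    simp only [contractedPlacement, initialPlacement_inr_eq_midpoint hB, midpoint_eq_smul_add,
      invOf_eq_inv]
    module
  have hs : √(1 - a ^ 2) ^ 2 = 1 - a ^ 2 := Real.sq_sqrt (by nlinarith [ha.1, ha.2])
  rw [dist_eq_norm, hsub, ← sq_eq_sq₀ (norm_nonneg _) (by positivity), norm_sub_sq_real,
    real_inner_smul_left, real_inner_smul_right, norm_smul, norm_smul, hu, hd, mul_pow, mul_pow,
    Real.norm_eq_abs, Real.norm_eq_abs, sq_abs, sq_abs, mul_pow, hs]
  linear_combination (-2 * (ℓ / 2 * √(1 - a ^ 2))) * horth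

/-- Contracting the polyhedron while the midpoints are pushed outwards along outer normals, and
turning the arms of the resulting star afterwards, is a sticky motion. -/
theorem isStickyMotion_contractedPlacement (a : unitInterval → ℝ)
    (u : unitInterval → (polyhedralLinkage P).graph.edgeSet → Space) (hPc : Convex ℝ P)
    (hac : Continuous a) (huc : ∀ e, Continuous fun t => u t e) (ha : ∀ t, a t ∈ Icc (0 : ℝ) 1)
    (hanti : Antitone a) (hu : ∀ t e, ‖u t e‖ = 1)
    (hn : ∀ t, 0 < a t → ∀ e : (polyhedralLinkage P).graph.edgeSet, IsOuterUnitNormal P e (u t e))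
    (hstick : ∀ s t, s ≤ t → a s = 0 → ∀ e e', u s e = u s e' → u t e = u t e') :
    (polyhedralLinkage P).midpointSubdivision.IsStickyMotion
      fun t => contractedPlacement P (a t) (u t) := by
  have key : ∀ s t : unitInterval, s ≤ t → ∀ (A A' : Set.extremePoints ℝ P)
      (e e' : (polyhedralLinkage P).graph.edgeSet), A ∈ (e : Sym2 (Set.extremePoints ℝ P)) →
      A' ∈ (e' : Sym2 (Set.extremePoints ℝ P)) → ∀ y ∈ Icc (0 : ℝ) 1, ∀ y' ∈ Icc (0 : ℝ) 1,
      AffineMap.lineMap (contractedPlacement P (a s) (u s) (Sum.inl A))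
        (contractedPlacement P (a s) (u s) (Sum.inr e)) y =
      AffineMap.lineMap (contractedPlacement P (a s) (u s) (Sum.inl A'))
        (contractedPlacement P (a s) (u s) (Sum.inr e')) y' →
      AffineMap.lineMap (contractedPlacement P (a t) (u t) (Sum.inl A))
        (contractedPlacement P (a t) (u t) (Sum.inr e)) y =
      AffineMap.lineMap (contractedPlacement P (a t) (u t) (Sum.inl A'))
        (contractedPlacement P (a t) (u t) (Sum.inr e')) y' := by
    intro s t hst A A' e e' hA hA' y hy y' hy' h
    rw [lineMap_contractedPlacement, lineMap_contractedPlacement] at h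
    have hle : 0 < (polyhedralLinkage P).length e := (polyhedralLinkage P).length_pos e e.2
    have hle' : 0 < (polyhedralLinkage P).length e' := (polyhedralLinkage P).length_pos e' e'.2
    rcases (ha s).1.eq_or_lt with h0 | hpos
    · have ht0 : a t = 0 := le_antisymm (h0 ▸ hanti hst) (ha t).1
      rw [lineMap_contractedPlacement, lineMap_contractedPlacement]
      simp only [← h0, ht0, zero_smul, zero_add, ne_eq, OfNat.ofNat_ne_zero, not_false_eq_true,
        zero_pow, sub_zero, Real.sqrt_one, mul_one] at h ⊢
      -- Touching points of two arms are equally far from the origin; unless this distance is zero,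
      -- the directions agree.
      have hnorm := congrArg norm h
      rw [norm_smul, norm_smul, hu, hu, mul_one, mul_one, Real.norm_of_nonneg
        (mul_nonneg hy.1 (by positivity)), Real.norm_of_nonneg
        (mul_nonneg hy'.1 (by positivity))] at hnorm
      rw [hnorm] at h ⊢
      by_cases hz : y' * ((polyhedralLinkage P).length e' / 2) = 0
      · rw [hz, zero_smul, zero_smul]
      · rw [hstick s t hst h0.symm e e' (smul_right_injective _ hz h)]
    · have hmem : ∀ (C : Set.extremePoints ℝ P) (f : (polyhedralLinkage P).graph.edgeSet),
          C ∈ (f : Sym2 (Set.extremePoints ℝ P)) → ∀ z ∈ Icc (0 : ℝ) 1,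
          halfEdgePoint C f z ∈ P := by
        rintro C f ⟨B, hB⟩ z hz
        exact hPc.segment_subset C.2.1 B.2.1 (halfEdgePoint_mem_segment hB hz)
      have hq : halfEdgePoint A e y = halfEdgePoint A' e' y' := by
        refine eq_of_add_normal_eq
          (σ := (a s)⁻¹ * (y * ((polyhedralLinkage P).length e / 2 * √(1 - a s ^ 2))))
          (σ' := (a s)⁻¹ * (y' * ((polyhedralLinkage P).length e' / 2 * √(1 - a s ^ 2))))
          (hmem A e hA y hy) (hmem A' e' hA' y' hy') ?_ ?_
          ((hn s hpos e).inner_halfEdgePoint_le hA hy)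
          ((hn s hpos e').inner_halfEdgePoint_le hA' hy') ?_
        · have := hy.1
          positivity
        · have := hy'.1
          positivity
        · have := congrArg (fun x => (a s)⁻¹ • x) h
          simpa only [smul_add, smul_smul, inv_mul_cancel₀ hpos.ne', one_smul] using this
      rcases halfEdgePoint_eq_cases hA hA' hy hy' hq with ⟨rfl, rfl, rfl⟩ | ⟨rfl, rfl, rfl⟩ |
        ⟨rfl, rfl, rfl⟩
      · simp
      · simp
      · rfl
  refine ⟨continuous_pi ?_, fun t => ?_, ?_⟩
  · rintro (A | e)
    · exact hac.smul continuous_const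
    · exact (hac.smul continuous_const).add
        ((continuous_const.mul (continuous_const.sub (hac.pow 2)).sqrt).smul (huc e))
  · rintro (A | e) (B | f) hadj
    · exact hadj.elim
    · exact dist_contractedPlacement (ha t) hadj (hu t f) fun h => hn t h f
    · rw [dist_comm]
      exact dist_contractedPlacement (ha t) hadj (hu t e) fun h => hn t h e
    · exact hadj.elim
  -- Bars listed from midpoint to vertex are reversed to reduce to `key`.
  · have hrev : ∀ {x : ℝ}, x ∈ Icc (0 : ℝ) 1 → 1 - x ∈ Icc (0 : ℝ) 1 := fun hx =>
      ⟨by linarith [hx.2], by linarith [hx.1]⟩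
    rintro s t hst (A | e) (B | f) (A' | e') (B' | f') hadj hadj' x hx x' hx' h
    all_goals first
      | exact hadj.elim
      | exact hadj'.elim
      | skip
    · exact key s t hst A A' f f' hadj hadj' x hx x' hx' h
    · rw [← AffineMap.lineMap_apply_one_sub (contractedPlacement P _ _ (Sum.inl B'))] at h ⊢
      exact key s t hst A B' f e' hadj hadj' x hx _ (hrev hx') h
    · rw [← AffineMap.lineMap_apply_one_sub (contractedPlacement P _ _ (Sum.inl B))] at h ⊢
      exact key s t hst B A' e f' hadj hadj' _ (hrev hx) x' hx' h
    · rw [← AffineMap.lineMap_apply_one_sub (contractedPlacement P _ _ (Sum.inl B)),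
        ← AffineMap.lineMap_apply_one_sub (contractedPlacement P _ _ (Sum.inl B'))] at h ⊢
      exact key s t hst B B' e e' hadj hadj' _ (hrev hx) _ (hrev hx') h

end Contraction

/-! ### Linear maps turning the arms into a plane and onto a line. -/

section Collapse

/-- A linear map which is the identity for `b = c = 0`, has its range in the `xy`-plane for `b = 1`
and in the `x`-axis for `b = c = 1`. -/
noncomputable def collapse (τ b c : ℝ) (n : Space) : Space :=
  !₂[n 0 + b * τ * n 1 + b * τ ^ 2 * n 2, (1 - c) * n 1, (1 - b) * n 2]

theorem collapse_zero_zero (τ : ℝ) (n : Space) : collapse τ 0 0 n = n := by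
  ext i
  fin_cases i <;> simp [collapse]

theorem collapse_eq_smul_iff (τ b c r : ℝ) (n n' : Space) :
    collapse τ b c n = r • collapse τ b c n' ↔
      n 0 + b * τ * n 1 + b * τ ^ 2 * n 2 = r * (n' 0 + b * τ * n' 1 + b * τ ^ 2 * n' 2) ∧
      (1 - c) * n 1 = r * ((1 - c) * n' 1) ∧ (1 - b) * n 2 = r * ((1 - b) * n' 2) := by
  constructor
  · intro h
    have h0 := congrArg (fun x : Space => x 0) h
    have h1 := congrArg (fun x : Space => x 1) h
    have h2 := congrArg (fun x : Space => x 2) h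
    simp [collapse] at h0 h1 h2
    exact ⟨h0, by simpa using h1, by simpa using h2⟩
  · rintro ⟨h0, h1, h2⟩
    ext i
    fin_cases i <;> simp [collapse, h0, h1, h2]

theorem exists_forall_collapse_ne_zero {ι : Type*} [Finite ι] (n : ι → Space)
    (hn : ∀ i, n i ≠ 0) : ∃ τ : ℝ, ∀ i, n i 0 + τ * n i 1 + τ ^ 2 * n i 2 ≠ 0 := by
  have hfin : ∀ i, {τ : ℝ | n i 0 + τ * n i 1 + τ ^ 2 * n i 2 = 0}.Finite := by
    intro i
    -- The coefficients are the coordinates of `n i`, so each `i` excludes only finitely many `τ`.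
    let p : Polynomial ℝ := .C (n i 0) + .X * .C (n i 1) + .X ^ 2 * .C (n i 2)
    have hp : p ≠ 0 := by
      intro hp
      apply hn i
      have hc := fun k => congrArg (fun q : Polynomial ℝ => q.coeff k) hp
      ext k
      fin_cases k
      · simpa [p] using hc 0
      · simpa [p, Polynomial.coeff_C, Polynomial.coeff_X_pow_mul'] using hc 1
      · simpa [p, Polynomial.coeff_C, Polynomial.coeff_X_pow_mul', Polynomial.coeff_X] using hc 2
    refine (p.roots.toFinset.finite_toSet).subset fun τ hτ => ?_
    have hroot : p.IsRoot τ := by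
      have h : n i 0 + τ * n i 1 + τ ^ 2 * n i 2 = 0 := hτ
      simp [p]
      linear_combination h
    simpa [hp] using hroot
  obtain ⟨τ, hτ⟩ := (Set.finite_iUnion hfin).infinite_compl.nonempty
  exact ⟨τ, fun i hi => hτ (mem_iUnion.2 ⟨i, hi⟩)⟩

theorem collapse_ne_zero {τ b c : ℝ} {n : Space} (hn : n ≠ 0)
    (hτ : n 0 + τ * n 1 + τ ^ 2 * n 2 ≠ 0) (hbc : b = 1 ∨ c = 0) : collapse τ b c n ≠ 0 := by
  intro h
  have h0 := congrArg (fun x : Space => x 0) h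
  have h1 := congrArg (fun x : Space => x 1) h
  have h2 := congrArg (fun x : Space => x 2) h
  simp only [collapse] at h0 h1 h2
  simp at h0 h1 h2
  -- For `b = 1` the first coordinate is the expression in `hτ`; otherwise `c = 0` and the map is
  -- triangular with nonzero diagonal.
  by_cases hb : b = 1
  · subst hb
    simp at h0
    exact hτ h0
  · have hc := hbc.resolve_left hb
    subst hc
    have h2' : n 2 = 0 := h2.resolve_left fun h => hb (by linarith)
    have h1' : n 1 = 0 := by simpa using h1
    apply hn
    ext k
    fin_cases k
    · simpa [h1', h2'] using h0
    · exact h1'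
    · exact h2'

theorem continuous_collapse (τ : ℝ) {X : Type*} [TopologicalSpace X] {b c : X → ℝ}
    (hb : Continuous b) (hc : Continuous c) (n : Space) :
    Continuous fun x => collapse τ (b x) (c x) n := by
  refine (PiLp.continuous_toLp 2 _).comp (continuous_pi fun i => ?_)
  fin_cases i <;> simp <;> fun_prop

/-- The vector `v` rescaled to length one. -/
noncomputable def unitVector (v : Space) : Space := ‖v‖⁻¹ • v

theorem norm_unitVector {v : Space} (hv : v ≠ 0) : ‖unitVector v‖ = 1 := norm_smul_inv_norm hv

/-- This turns equality of directions into a linear relation, which linear maps carry along. -/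
theorem unitVector_eq_iff {v w : Space} (hv : v ≠ 0) (hw : w ≠ 0) :
    unitVector v = unitVector w ↔ ∃ r : ℝ, 0 < r ∧ v = r • w := by
  have hv' := norm_pos_iff.2 hv
  have hw' := norm_pos_iff.2 hw
  constructor
  · intro h
    refine ⟨‖v‖ * ‖w‖⁻¹, by positivity, ?_⟩
    rw [mul_smul, ← unitVector, ← h, unitVector, smul_inv_smul₀ hv'.ne']
  · rintro ⟨r, hr, rfl⟩
    rw [unitVector, unitVector, norm_smul, Real.norm_of_nonneg hr.le, smul_smul]
    congr 1
    field_simp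

end Collapse

/-! ### Assembly of the two motions. -/

theorem mainTheorem2 (P : Set Space) (hP : IsConvexPolyhedron P) :
    ∃ S : unitInterval →
        (Set.extremePoints ℝ P ⊕ (polyhedralLinkage P).graph.edgeSet) → Space,
      (polyhedralLinkage P).midpointSubdivision.IsStickyMotion S ∧
      S 0 = initialPlacement P ∧
      (∀ v, S 1 v 2 = 0) ∧
      ∃ T : unitInterval →
          (Set.extremePoints ℝ P ⊕ (polyhedralLinkage P).graph.edgeSet) → Space,
        (polyhedralLinkage P).midpointSubdivision.IsStickyMotion T ∧
        T 0 = S 1 ∧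
        Collinear ℝ (Set.range (T 1)) := by
  obtain ⟨⟨F, hF⟩, hint⟩ := hP
  have hconv : Convex ℝ P := hF ▸ convex_convexHull ℝ _
  have hfinV : Finite (Set.extremePoints ℝ P) :=
    (F.finite_toSet.subset (hF ▸ extremePoints_convexHull_subset)).to_subtype
  choose n hn using fun e : (polyhedralLinkage P).graph.edgeSet =>
    exists_isOuterUnitNormal hint e.2
  have hn0 : ∀ e, n e ≠ 0 := fun e h => by
    have := (hn e).1
    rw [h, norm_zero] at this
    exact zero_ne_one this
  obtain ⟨τ, hτ⟩ := exists_forall_collapse_ne_zero n hn0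
  have hne : ∀ {b c : ℝ}, b = 1 ∨ c = 0 → ∀ e, collapse τ b c (n e) ≠ 0 := fun h e =>
    collapse_ne_zero (hn0 e) (hτ e) h
  -- Contraction fills the first half of the time, turning into the plane the second; the star is
  -- reached at time `1 / 2`.
  let a : unitInterval → ℝ := fun t => max (1 - 2 * (t : ℝ)) 0
  let b : unitInterval → ℝ := fun t => max (2 * (t : ℝ) - 1) 0
  have hac : Continuous a := by fun_prop
  have hbc : Continuous b := by fun_prop
  have hb0 : ∀ t, 0 < a t → b t = 0 := by
    intro t ht
    rcases lt_max_iff.1 ht with h | h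
    · exact max_eq_right (by linarith)
    · exact absurd h (lt_irrefl 0)
  have hb1 : ∀ t, b t = 1 → t = 1 := by
    intro t ht
    have : b t ≤ t := max_le (by linarith [t.2.2]) t.2.1
    rw [ht] at this
    exact Subtype.ext (le_antisymm t.2.2 this)
  have hucont : ∀ {f g : unitInterval → ℝ}, Continuous f → Continuous g →
      (∀ t, f t = 1 ∨ g t = 0) → ∀ e,
      Continuous fun t => unitVector (collapse τ (f t) (g t) (n e)) := by
    intro f g hf hg h e
    have := continuous_collapse τ hf hg (n e)
    exact (this.norm.inv₀ fun t => norm_ne_zero_iff.2 (hne (h t) e)).smul this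
  have hb_one : b 1 = 1 := by norm_num [b]
  have ha_one : a 1 = 0 := by norm_num [a]
  have ha_zero : a 0 = 1 := by norm_num [a]
  refine ⟨fun t => contractedPlacement P (a t) fun e => unitVector (collapse τ (b t) 0 (n e)),
    isStickyMotion_contractedPlacement _ _ hconv hac
      (hucont hbc continuous_const fun _ => Or.inr rfl) ?_ ?_
      (fun t e => norm_unitVector (hne (Or.inr rfl) e)) ?_ ?_, ?_, ?_,
    fun t => contractedPlacement P 0 fun e => unitVector (collapse τ 1 (t : ℝ) (n e)),
    isStickyMotion_contractedPlacement _ _ hconv continuous_const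
      (hucont continuous_const continuous_subtype_val fun _ => Or.inl rfl)
      (fun _ => ⟨le_rfl, zero_le_one⟩) antitone_const
      (fun t e => norm_unitVector (hne (Or.inl rfl) e))
      (fun _ h => absurd h (lt_irrefl 0)) ?_, ?_, ?_⟩
  · exact fun t => ⟨le_max_right _ _, max_le (by linarith [t.2.1]) zero_le_one⟩
  · intro s t hst
    have : (s : ℝ) ≤ t := hst
    exact max_le_max (by linarith) le_rfl
  · intro t ht e
    rw [hb0 t ht, collapse_zero_zero, unitVector, (hn e).1, inv_one, one_smul]
    exact hn e
  · intro s t hst _ e e' h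
    -- The map is singular only for `b s = 1`, which forces `s = t = 1`; before that the relation
    -- between the images lifts to the normals.
    by_cases hs : b s = 1
    · have hs1 := hb1 s hs
      subst hs1
      rwa [le_antisymm unitInterval.le_one' hst]
    · rw [unitVector_eq_iff (hne (Or.inr rfl) e) (hne (Or.inr rfl) e')] at h ⊢
      obtain ⟨r, hr, h⟩ := h
      refine ⟨r, hr, ?_⟩
      rw [collapse_eq_smul_iff] at h ⊢
      obtain ⟨h0, h1, h2⟩ := h
      have h2' : n e 2 = r * n e' 2 :=
        mul_left_cancel₀ (sub_ne_zero.2 (Ne.symm hs)) (by linear_combination h2)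
      have h1' : n e 1 = r * n e' 1 := by linear_combination h1
      have h0' : n e 0 = r * n e' 0 := by
        linear_combination h0 - b s * τ * h1' - b s * τ ^ 2 * h2'
      rw [h0', h1', h2']
      exact ⟨by ring, by ring, by ring⟩
  · funext v
    rcases v with A | e
    · simp [contractedPlacement, ha_zero, initialPlacement, Linkage.subdividedPlacement]
    · simp [contractedPlacement, ha_zero]
  · rintro (A | e)
    · simp [contractedPlacement, ha_one]
    · simp [contractedPlacement, ha_one, hb_one, unitVector, collapse]
  · intro s t hst _ e e' h
    by_cases hs : (s : ℝ) = 1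
    · have hs1 : s = 1 := Subtype.ext hs
      subst hs1
      rwa [le_antisymm unitInterval.le_one' hst]
    · rw [unitVector_eq_iff (hne (Or.inl rfl) e) (hne (Or.inl rfl) e')] at h ⊢
      obtain ⟨r, hr, h⟩ := h
      refine ⟨r, hr, ?_⟩
      rw [collapse_eq_smul_iff] at h ⊢
      -- With `b = 1` the third coordinate is zero and the first does not depend on time; only the
      -- second has to be rescaled.
      obtain ⟨h0, h1, -⟩ := h
      have h1' : n e 1 = r * n e' 1 :=
        mul_left_cancel₀ (sub_ne_zero.2 (Ne.symm hs)) (by linear_combination h1)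
      exact ⟨h0, by rw [h1']; ring, by ring⟩
  · funext v
    simp [ha_one, hb_one]
  · rw [collinear_iff_exists_forall_eq_smul_vadd]
    refine ⟨0, EuclideanSpace.single 0 1, ?_⟩
    rintro _ ⟨v, rfl⟩
    refine ⟨contractedPlacement P 0 (fun e => unitVector (collapse τ 1 1 (n e))) v 0, ?_⟩
    rcases v with A | e
    · simp [contractedPlacement]
    · ext i
      fin_cases i <;> simp [contractedPlacement, unitVector, collapse]
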